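/- **Conventions.** An inner product is a nondegenerate symmetric bilinear form; it has signature $(p,q)$ if $p$ is the maximal dimension of a negative definite (timelike) subspace and $q$ the maximal dimension of a positive definite (spacelike) subspace. A $2$-plane $\pi$ is spacelike (resp. timelike) if the inner product is positive (resp. negative) definite on $\pi$. The curvature operator of a pseudo-Riemannian metric $g$ with Levi-Civita connection $\nabla$ is $R(x,y)=\nabla_x\nabla_y-\nabla_y\nabla_x-\nabla_{[x,y]}$. For an oriented nondegenerate $2$-plane $\pi$ with oriented basis $\{x,y\}$ put $$R(\pi)=|g(x,x)g(y,y)-g(x,y)^2|^{-1/2}R(x,y).$$ $R$ is *spacelike (resp. timelike) rank $2$ Jordan IP* at a point if $\operatorname{rank}R(\pi)=2$ for every oriented spacelike (resp. timelike) $2$-plane $\pi$ in the tangent space there, and any two of these operators are conjugate (have the same Jordan normal form). For a self-adjoint map $\phi$, put $R_\phi(x,y)z=g(\phi y,z)\phi x-g(\phi x,z)\phi y$. **Lemma 5.2.** Let $\{e_1,\dots,e_p,\tilde e_1,\dots,\tilde e_p\}$ be a basis of a real vector space $V$, and let $\{x^1,\dots,x^p,\tilde x^1,\dots,\tilde x^p\}$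 be the dual basis of $V^*$. Define an inner product of signature $(p,p)$ on $V$ by $(e_i,\tilde e_j)=\delta_{ij}$ and $(e_i,e_j)=(\tilde e_i,\tilde e_j)=0$, and give $W:=V\oplus\mathbb R$ the direct sum inner product, which has signature $(p,p+1)$. Let $f=f(\tilde x^1,\dots,\tilde x^p)$ be a smooth real valued function on $\mathbb R^p$ with $df(0)=0$ and $\det(\partial_i\partial_jf)(0)\neq0$. Then $F:=\operatorname{id}\oplus f:V\to W$, $F(v)=(v,f(\tilde x^1(v),\dots,\tilde x^p(v)))$, is a smooth embedding, and there is a connected open neighbourhood $\mathcal O$ of the origin of $V$ such that: 1. the metric $g$ induced on $\mathcal O$ by $F$ is a smooth pseudo-Riemannian metric of signature $(p,p)$; 2. at every point of $\mathcal O$ the curvature operator $R$ of $g$ is spacelike rank $2$ Jordan IP and timelike rank $2$ Jordan IP, and it is nilpotent: $R(x,y)^2=0$ for all tangent vectors $x,y$; 3. there is a smooth unit normal field along $F|_{\mathcal O}$, and for every $P\in\mathcal O$ and each unit normal $\nu$ at $P$ (i.e. $\nu\perp\operatorname{range}dF_P$ and $(\nu,\nu)=\pm1$), one has $(\nu,\nu)=1$,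 and the shape operator $S$, defined by $g(Sx,y)=(\partial_x\partial_yF,\nu)$, is self-adjoint and satisfies $R=R_S$ and $S^2=0$. -/

import Mathlib

open scoped ContDiff

set_option maxSynthPendingDepth 3

noncomputable section

namespace JordanIP

section Algebra

variable {E : Type*} [NormedAddCommGroup E] [NormedSpace ℝ E]

/-- The bilinear form `B` is an inner product of signature `(p, q)`: it is symmetric and
nondegenerate, with `p` negative (timelike) and `q` positive (spacelike) directions. The condition
on the dimension together with the other two says that the radical is zero. -/
structure HasSignature (B : E →L[ℝ] E →L[ℝ] ℝ) (p q : ℕ) : Prop where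
  symm : ∀ x y, B x y = B y x
  finiteDimensional : FiniteDimensional ℝ E
  finrank_eq : Module.finrank ℝ E = p + q
  sigNeg_eq : sigNeg (B.toBilinForm.toQuadraticMap) = p
  sigPos_eq : sigPos (B.toBilinForm.toQuadraticMap) = q

/-- `(x, y)` is an (oriented) basis of a spacelike `2`-plane: the plane has signature `(0, 2)`. -/
def IsSpacelikePair (B : E →L[ℝ] E →L[ℝ] ℝ) (x y : E) : Prop :=
  LinearIndependent ℝ ![x, y] ∧ ∀ v ∈ Submodule.span ℝ {x, y}, v ≠ 0 → 0 < B v v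

/-- `(x, y)` is an (oriented) basis of a timelike `2`-plane: the plane has signature `(2, 0)`. -/
def IsTimelikePair (B : E →L[ℝ] E →L[ℝ] ℝ) (x y : E) : Prop :=
  LinearIndependent ℝ ![x, y] ∧ ∀ v ∈ Submodule.span ℝ {x, y}, v ≠ 0 → B v v < 0

/-- The skew-symmetric curvature operator `R(π)` of the oriented plane `π` with oriented basis
`(x, y)`. -/
def skewCurvature (B : E →L[ℝ] E →L[ℝ] ℝ) (R : E → E → E →L[ℝ] E) (x y : E) : E →L[ℝ] E :=
  (Real.sqrt |B x x * B y y - B x y ^ 2|)⁻¹ • R x y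

/-- Jordan equivalence: `T` and `T'` are conjugate. -/
def JordanEquivalent (T T' : E →L[ℝ] E) : Prop :=
  ∃ Θ : E ≃ₗ[ℝ] E, ∀ v, T v = Θ (T' (Θ.symm v))

/-- `R` is spacelike rank `r` Jordan IP: `R(π)` has rank `r` for every oriented spacelike
`2`-plane `π`, and all these operators have the same Jordan normal form. -/
def IsSpacelikeRankJordanIP (B : E →L[ℝ] E →L[ℝ] ℝ) (R : E → E → E →L[ℝ] E) (r : ℕ) : Prop :=
  (∀ x y, IsSpacelikePair B x y →
    Module.finrank ℝ (skewCurvature B R x y).range = r) ∧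
  ∀ x y x' y', IsSpacelikePair B x y → IsSpacelikePair B x' y' →
    JordanEquivalent (skewCurvature B R x y) (skewCurvature B R x' y')

/-- `R` is timelike rank `r` Jordan IP. -/
def IsTimelikeRankJordanIP (B : E →L[ℝ] E →L[ℝ] ℝ) (R : E → E → E →L[ℝ] E) (r : ℕ) : Prop :=
  (∀ x y, IsTimelikePair B x y →
    Module.finrank ℝ (skewCurvature B R x y).range = r) ∧
  ∀ x y x' y', IsTimelikePair B x y → IsTimelikePair B x' y' →
    JordanEquivalent (skewCurvature B R x y) (skewCurvature B R x' y')

/-- The curvature operator `R_φ(x, y) z = (φ y, z) φ x - (φ x, z) φ y`. -/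
def curvatureOf (B : E →L[ℝ] E →L[ℝ] ℝ) (φ : E →L[ℝ] E) (x y : E) : E →L[ℝ] E :=
  (B (φ y)).smulRight (φ x) - (B (φ x)).smulRight (φ y)

end Algebra

section Metric

/-! A metric on (an open subset of) a finite-dimensional real vector space `E` is a field
`g : E → E →L[ℝ] E →L[ℝ] ℝ` of bilinear forms; tangent vectors are elements of `E`. -/

variable {E : Type*} [NormedAddCommGroup E] [NormedSpace ℝ E]

/-- `g` is a smooth pseudo-Riemannian metric of signature `(p, q)` on the open set `O`. -/
structure IsPseudoRiemannianOn (g : E → E →L[ℝ] E →L[ℝ] ℝ) (O : Set E) (p q : ℕ) : Prop where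
  contDiffOn : ContDiffOn ℝ ∞ g O
  hasSignature : ∀ P ∈ O, HasSignature (g P) p q

/-- The musical isomorphism `♯` of a nondegenerate form `B`: `B (sharp B α) z = α z`. -/
def sharp (B : E →L[ℝ] E →L[ℝ] ℝ) : (E →L[ℝ] ℝ) →L[ℝ] E :=
  ContinuousLinearMap.inverse B

/-- Christoffel symbols of the first kind:
`½ ((∂_x g)(y, z) + (∂_y g)(x, z) - (∂_z g)(x, y))`. -/
def christoffelFirst (g : E → E →L[ℝ] E →L[ℝ] ℝ) (P : E) : E →L[ℝ] E →L[ℝ] E →L[ℝ] ℝ :=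
  (1 / 2 : ℝ) • (fderiv ℝ g P + (fderiv ℝ g P).flip -
    ((ContinuousLinearMap.flipₗᵢ ℝ E E ℝ).toContinuousLinearEquiv :
      (E →L[ℝ] E →L[ℝ] ℝ) →L[ℝ] (E →L[ℝ] E →L[ℝ] ℝ)).comp (fderiv ℝ g P).flip)

/-- Christoffel symbols `Γ(x, y)` of the Levi-Civita connection (second kind). -/
def christoffel (g : E → E →L[ℝ] E →L[ℝ] ℝ) (P : E) : E →L[ℝ] E →L[ℝ] E :=
  ContinuousLinearMap.compL ℝ E (E →L[ℝ] ℝ) E (sharp (g P)) ∘L christoffelFirst g P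

/-- The Levi-Civita covariant derivative `∇_X Y` of vector fields. -/
def covDeriv (g : E → E →L[ℝ] E →L[ℝ] ℝ) (X Y : E → E) (P : E) : E :=
  fderiv ℝ Y P (X P) + christoffel g P (X P) (Y P)

/-- The curvature operator
`R(x, y) = ∂_x Γ(y, ·) - ∂_y Γ(x, ·) + [Γ(x, ·), Γ(y, ·)]` at the point `P`, i.e.
`R(x, y) = ∇_x ∇_y - ∇_y ∇_x - ∇_[x, y]`; see `covDeriv_comm`. -/
def curvature (g : E → E →L[ℝ] E →L[ℝ] ℝ) (P : E) (x y : E) : E →L[ℝ] E :=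
  fderiv ℝ (christoffel g) P x y - fderiv ℝ (christoffel g) P y x +
    (christoffel g P x ∘L christoffel g P y - christoffel g P y ∘L christoffel g P x)

lemma christoffelFirst_apply (g : E → E →L[ℝ] E →L[ℝ] ℝ) (P x y z : E) :
    christoffelFirst g P x y z =
      1 / 2 * (fderiv ℝ g P x y z + fderiv ℝ g P y x z - fderiv ℝ g P z x y) := by
  simp [christoffelFirst]

lemma apply_sharp {B : E →L[ℝ] E →L[ℝ] ℝ} (hB : B.IsInvertible) (α : E →L[ℝ] ℝ) :
    B (sharp B α) = α := by
  obtain ⟨e, rfl⟩ := hB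
  simp [sharp]

lemma apply_christoffel {g : E → E →L[ℝ] E →L[ℝ] ℝ} {P : E} (hP : (g P).IsInvertible)
    (x y z : E) :
    g P (christoffel g P x y) z =
      1 / 2 * (fderiv ℝ g P x y z + fderiv ℝ g P y x z - fderiv ℝ g P z x y) := by
  rw [← christoffelFirst_apply]
  exact congrArg (fun α => α z) (apply_sharp hP (christoffelFirst g P x y))

lemma fderiv_metric_symm {g : E → E →L[ℝ] E →L[ℝ] ℝ} {P : E}
    (hs : ∀ᶠ Q in nhds P, ∀ x y, g Q x y = g Q y x) (hg : DifferentiableAt ℝ g P) (u x y : E) :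
    fderiv ℝ g P u x y = fderiv ℝ g P u y x := by
  have h1 : (fun Q : E => g Q x y) =ᶠ[nhds P] fun Q : E => g Q y x := hs.mono fun Q h => h x y
  have h2 := congrArg (fun L : E →L[ℝ] ℝ => L u) (h1.fderiv_eq (𝕜 := ℝ))
  have key : ∀ a b, fderiv ℝ (fun Q => g Q a b) P u = fderiv ℝ g P u a b := by
    intro a b
    have := ((hg.hasFDerivAt.clm_apply (hasFDerivAt_const (𝕜 := ℝ) a P)).clm_apply
      (hasFDerivAt_const (𝕜 := ℝ) b P)).fderiv
    rw [this]; simp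
  simpa [key] using h2

/-- The connection is compatible with the metric. -/
lemma fderiv_metric_apply {g : E → E →L[ℝ] E →L[ℝ] ℝ} {P : E} {X Y Z : E → E}
    (hs : ∀ᶠ Q in nhds P, ∀ x y, g Q x y = g Q y x)
    (hP : (g P).IsInvertible) (hg : DifferentiableAt ℝ g P)
    (hY : DifferentiableAt ℝ Y P) (hZ : DifferentiableAt ℝ Z P) :
    fderiv ℝ (fun Q => g Q (Y Q) (Z Q)) P (X P) =
      g P (covDeriv g X Y P) (Z P) + g P (Y P) (covDeriv g X Z P) := by
  have hsD := fderiv_metric_symm hs hg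
  have hsP := hs.self_of_nhds
  have h := ((hg.hasFDerivAt.clm_apply hY.hasFDerivAt).clm_apply hZ.hasFDerivAt).fderiv
  rw [h]
  simp only [covDeriv, map_add, add_apply, ContinuousLinearMap.comp_apply,
    ContinuousLinearMap.flip_apply]
  rw [hsP (Y P) (christoffel g P (X P) (Z P)), apply_christoffel hP, apply_christoffel hP,
    hsD (X P) (Z P) (Y P), hsD (Y P) (X P) (Z P), hsD (Z P) (X P) (Y P)]
  rw [hsD (Z P) (Y P) (X P)]
  ring

/-- The connection is torsion free. -/
lemma covDeriv_sub_covDeriv {g : E → E →L[ℝ] E →L[ℝ] ℝ} {P : E} {X Y : E → E}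
    (hs : ∀ᶠ Q in nhds P, ∀ x y, g Q x y = g Q y x) (hg : DifferentiableAt ℝ g P) :
    covDeriv g X Y P - covDeriv g Y X P = VectorField.lieBracket ℝ X Y P := by
  have hΓ : christoffel g P (X P) (Y P) = christoffel g P (Y P) (X P) := by
    have : christoffelFirst g P (X P) (Y P) = christoffelFirst g P (Y P) (X P) := by
      ext z
      rw [christoffelFirst_apply, christoffelFirst_apply, fderiv_metric_symm hs hg z (X P) (Y P)]
      ring
    simp [christoffel, this]
  simp only [covDeriv, VectorField.lieBracket, hΓ]
  abel

/-- The curvature operator is `∇_X ∇_Y - ∇_Y ∇_X - ∇_[X, Y]`. -/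
lemma covDeriv_comm {g : E → E →L[ℝ] E →L[ℝ] ℝ} {P : E} {X Y Z : E → E}
    (hΓ : DifferentiableAt ℝ (christoffel g) P)
    (hX : DifferentiableAt ℝ X P) (hY : DifferentiableAt ℝ Y P) (hZ : ContDiffAt ℝ 2 Z P) :
    covDeriv g X (covDeriv g Y Z) P - covDeriv g Y (covDeriv g X Z) P -
      covDeriv g (VectorField.lieBracket ℝ X Y) Z P = curvature g P (X P) (Y P) (Z P) := by
  have hZ1 : DifferentiableAt ℝ Z P := hZ.differentiableAt (by norm_num)
  have hZ2 : DifferentiableAt ℝ (fderiv ℝ Z) P :=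
    (hZ.fderiv_right (m := 1) (by norm_num)).differentiableAt (by norm_num)
  have hsymm := (hZ.isSymmSndFDerivAt (by simp)).eq (X P) (Y P)
  have key : ∀ A : E → E, DifferentiableAt ℝ A P → ∀ u, fderiv ℝ (covDeriv g A Z) P u =
      fderiv ℝ (fderiv ℝ Z) P u (A P) + fderiv ℝ Z P (fderiv ℝ A P u) +
      (fderiv ℝ (christoffel g) P u (A P) (Z P) + christoffel g P (fderiv ℝ A P u) (Z P) +
        christoffel g P (A P) (fderiv ℝ Z P u)) := by
    intro A hA u
    have h := ((hZ2.hasFDerivAt.clm_apply hA.hasFDerivAt).add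
      ((hΓ.hasFDerivAt.clm_apply hA.hasFDerivAt).clm_apply hZ1.hasFDerivAt)).fderiv
    have h' : fderiv ℝ (covDeriv g A Z) P = _ := h
    rw [h']
    simp
    abel
  simp only [covDeriv] at key ⊢
  rw [key Y hY, key X hX]
  simp only [curvature, VectorField.lieBracket, map_add, map_sub, add_apply, sub_apply,
    ContinuousLinearMap.comp_apply, hsymm]
  abel

end Metric

section Hypersurface

variable {E W : Type*} [NormedAddCommGroup E] [NormedSpace ℝ E]
  [NormedAddCommGroup W] [NormedSpace ℝ W]

/-- The metric induced on `E` by a map `F : E → W` into the inner product space `(W, B)`. -/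
def inducedMetric (B : W →L[ℝ] W →L[ℝ] ℝ) (F : E → W) (P : E) : E →L[ℝ] E →L[ℝ] ℝ :=
  B.bilinearComp (fderiv ℝ F P) (fderiv ℝ F P)

/-- `ν` is a unit normal at the point `P` of the hypersurface parametrized by `F`. -/
def IsUnitNormal (B : W →L[ℝ] W →L[ℝ] ℝ) (F : E → W) (P : E) (ν : W) : Prop :=
  (∀ x, B (fderiv ℝ F P x) ν = 0) ∧ |B ν ν| = 1

/-- The second fundamental form `L(x, y) = (∂_x ∂_y F, ν)`. -/
def secondFundamentalForm (B : W →L[ℝ] W →L[ℝ] ℝ) (F : E → W) (P : E) (ν : W) :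
    E →L[ℝ] E →L[ℝ] ℝ :=
  ContinuousLinearMap.compL ℝ E W ℝ (B.flip ν) ∘L fderiv ℝ (fderiv ℝ F) P

/-- The shape operator `S`, defined by `g (S x) y = L(x, y)`. -/
def shapeOperator (B : W →L[ℝ] W →L[ℝ] ℝ) (F : E → W) (P : E) (ν : W) : E →L[ℝ] E :=
  sharp (inducedMetric B F P) ∘L secondFundamentalForm B F P ν

end Hypersurface

section Graph

variable {p : ℕ} {V : Type*} [NormedAddCommGroup V] [NormedSpace ℝ V]

/-- The neutral inner product on a vector space `V` with basis `e₁, …, e_p, ẽ₁, …, ẽ_p`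
(`e i = b (Sum.inl i)` and `ẽ i = b (Sum.inr i)`), that is,
`(u, v) = ∑ i, (xⁱ(u) x̃ⁱ(v) + x̃ⁱ(u) xⁱ(v))` in terms of the dual basis. -/
def neutralForm (b : Module.Basis (Fin p ⊕ Fin p) ℝ V) : V →L[ℝ] V →L[ℝ] ℝ :=
  let x (k : Fin p ⊕ Fin p) : V →L[ℝ] ℝ := (ContinuousLinearMap.proj k).comp
    b.equivFunL.toContinuousLinearMap
  ∑ i, ((x (Sum.inl i)).smulRight (x (Sum.inr i)) + (x (Sum.inr i)).smulRight (x (Sum.inl i)))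

lemma neutralForm_apply (b : Module.Basis (Fin p ⊕ Fin p) ℝ V) (u v : V) :
    neutralForm b u v = ∑ i, (b.repr u (Sum.inl i) * b.repr v (Sum.inr i) +
      b.repr u (Sum.inr i) * b.repr v (Sum.inl i)) := by
  simp [neutralForm, Module.Basis.equivFunL]

/-- The direct sum inner product on `W = V ⊕ ℝ`. -/
def directSumForm (B : V →L[ℝ] V →L[ℝ] ℝ) : V × ℝ →L[ℝ] V × ℝ →L[ℝ] ℝ :=
  B.bilinearComp (ContinuousLinearMap.fst ℝ V ℝ) (ContinuousLinearMap.fst ℝ V ℝ) +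
    (ContinuousLinearMap.mul ℝ ℝ).bilinearComp (ContinuousLinearMap.snd ℝ V ℝ)
      (ContinuousLinearMap.snd ℝ V ℝ)

/-- The graph embedding `F = id ⊕ f`, where `f` is regarded as a function of the coordinates
`x̃¹, …, x̃ᵖ` of a point of `V`. -/
def graphMap (b : Module.Basis (Fin p ⊕ Fin p) ℝ V) (f : (Fin p → ℝ) → ℝ) (v : V) : V × ℝ :=
  (v, f fun i => b.repr v (Sum.inr i))

/-- The Hessian matrix `(∂_i ∂_j f)(y)`. -/
def hessian (f : (Fin p → ℝ) → ℝ) (y : Fin p → ℝ) : Matrix (Fin p) (Fin p) ℝ :=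
  Matrix.of fun i j =>
    fderiv ℝ (fun z => fderiv ℝ f z (Pi.single j 1)) y (Pi.single i 1)

variable (b : Module.Basis (Fin p ⊕ Fin p) ℝ V)

/-- The inner product on `W = V ⊕ ℝ`: the direct sum of the neutral form and the standard one. -/
def ambientForm : V × ℝ →L[ℝ] V × ℝ →L[ℝ] ℝ := directSumForm (neutralForm b)

/-- The metric of the graph hypersurface, in the global parametrization `graphMap`. -/
def graphMetric (f : (Fin p → ℝ) → ℝ) : V → V →L[ℝ] V →L[ℝ] ℝ :=
  inducedMetric (ambientForm b) (graphMap b f)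

/-- The curvature operator `ᵍR` of the graph hypersurface at the point with parameter `P`. -/
def graphCurvature (f : (Fin p → ℝ) → ℝ) : V → V → V → V →L[ℝ] V :=
  curvature (graphMetric b f)

/-- The shape operator of the graph hypersurface at the point with parameter `P`, with respect to
the unit normal vector `ν`. -/
def graphShape (f : (Fin p → ℝ) → ℝ) (P : V) (ν : V × ℝ) : V →L[ℝ] V :=
  shapeOperator (ambientForm b) (graphMap b f) P ν

end Graph

end JordanIP

end

open JordanIP

/-! Let `N` be the span of the `e i`. It is totally isotropic and is the kernel of the projection `π
= tildeProj b`. Since `f` depends only on `π`, the induced metric is `g = (·,·) + (df ∘ π) ⊗ (df ∘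
π)`. A functional `β` of the tilde coordinates has a lift `dualLift b β` in `N` that represents `β ∘
π` for the neutral form and equally for `g` at every point (`graphMetric_dualLift`). This makes the
connection explicit: `Γ(x, y) = H(πx, πy) a`, where `H` is the second derivative of `f` and `a` is
the lift of `df`.

As `π a = 0`, the terms quadratic in `Γ` vanish; third derivatives of `f` cancel by symmetry. What
is left is `R = R_S` with `S = dualLift ∘ H ∘ π` (`graphCurvature_eq`). From `π ∘ dualLift = 0`
follow `S² = 0` and `R(x, y)² = 0`.

A definite plane meets the null space `N` only in zero, so `π` is injective on it. Where the Hessian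
is nondegenerate `S` is then injective on it too, and `R(x, y)` has rank two
(`finrank_range_graphCurvature`). Square-zero operators of equal rank are conjugate
(`exists_conj_of_comp_self_eq_zero`), which gives the Jordan IP property. -/

namespace JordanIP

/-! ### Signatures, invertibility and Gram determinants of bilinear forms. -/

section Signature

variable {E E' : Type*} [NormedAddCommGroup E] [NormedSpace ℝ E]
  [NormedAddCommGroup E'] [NormedSpace ℝ E']

/-- A form that is a weighted sum of squares in suitable coordinates has the signature given by the
signs of the weights. -/
lemma HasSignature.of_weightedSumSquares {ι : Type*} [Fintype ι] [FiniteDimensional ℝ E]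
    {B : E →L[ℝ] E →L[ℝ] ℝ} (w : ι → ℝ) (e : E →ₗ[ℝ] ι → ℝ) (he : Function.Injective e)
    (hcard : Module.finrank ℝ E = Fintype.card ι) (hsymm : ∀ x y, B x y = B y x)
    (hB : ∀ x, B x x = ∑ i, w i * (e x i * e x i)) (hw : ∀ i, w i ≠ 0) :
    HasSignature B {i | w i < 0}.ncard {i | 0 < w i}.ncard := by
  let e' : E ≃ₗ[ℝ] (ι → ℝ) := LinearMap.linearEquivOfInjective e he (by simpa using hcard)
  have hequiv : QuadraticMap.Equivalent (B.toBilinForm.toQuadraticMap)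
      (QuadraticMap.weightedSumSquares ℝ w) := by
    refine ⟨⟨e', fun x => ?_⟩⟩
    simp only [QuadraticMap.weightedSumSquares_apply, smul_eq_mul]
    exact (hB x).symm
  refine ⟨hsymm, inferInstance, ?_, QuadraticForm.sigNeg_of_equiv_weightedSumSquares hequiv,
    QuadraticForm.sigPos_of_equiv_weightedSumSquares hequiv⟩
  have hcompl : {i | 0 < w i} = {i | w i < 0}ᶜ := by
    ext i
    simpa using ⟨le_of_lt, fun h => lt_of_le_of_ne h (hw i).symm⟩
  rw [hcompl, Set.ncard_add_ncard_compl, hcard, Nat.card_eq_fintype_card]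

/-- Signature is invariant under linear isometries. -/
lemma HasSignature.of_isometry {B : E →L[ℝ] E →L[ℝ] ℝ} {B' : E' →L[ℝ] E' →L[ℝ] ℝ} {p q : ℕ}
    (h : HasSignature B p q) (T : E' ≃ₗ[ℝ] E) (hT : ∀ x y, B' x y = B (T x) (T y)) :
    HasSignature B' p q := by
  have := h.finiteDimensional
  have hequiv : QuadraticMap.Equivalent (B'.toBilinForm.toQuadraticMap)
      (B.toBilinForm.toQuadraticMap) := ⟨⟨T, fun x => (hT x x).symm⟩⟩
  refine ⟨fun x y => by rw [hT, hT, h.symm], T.symm.finiteDimensional, ?_, ?_, ?_⟩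
  · rw [T.finrank_eq, h.finrank_eq]
  · rw [hequiv.sigNeg_eq, h.sigNeg_eq]
  · rw [hequiv.sigPos_eq, h.sigPos_eq]

/-- A form with zero left kernel on a finite-dimensional space is invertible. -/
lemma isInvertible_of_nondegenerate [FiniteDimensional ℝ E] {B : E →L[ℝ] E →L[ℝ] ℝ}
    (hB : ∀ x, B x = 0 → x = 0) : B.IsInvertible := by
  have hfin : Module.finrank ℝ E = Module.finrank ℝ (E →L[ℝ] ℝ) := by
    rw [← (LinearMap.toContinuousLinearMap : (E →ₗ[ℝ] ℝ) ≃ₗ[ℝ] E →L[ℝ] ℝ).finrank_eq]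
    exact Subspace.dual_finrank_eq.symm
  have hinj : Function.Injective (B : E →ₗ[ℝ] E →L[ℝ] ℝ) :=
    (injective_iff_map_eq_zero _).2 hB
  exact ⟨(LinearMap.linearEquivOfInjective _ hinj hfin).toContinuousLinearEquiv, rfl⟩

/-- A definite plane has nonzero Gram determinant. -/
lemma gram_ne_zero {B : E →L[ℝ] E →L[ℝ] ℝ} (hsymm : ∀ x y, B x y = B y x) {x y : E}
    (hli : LinearIndependent ℝ ![x, y])
    (hdef : ∀ v ∈ Submodule.span ℝ {x, y}, v ≠ 0 → B v v ≠ 0) :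
    B x x * B y y - B x y ^ 2 ≠ 0 := by
  intro h0
  have hx0 : x ≠ 0 := hli.ne_zero 0
  have hxx : B x x ≠ 0 := hdef x (Submodule.subset_span (by simp)) hx0
  -- Up to the factor `B x x` this vector is the part of `y` orthogonal to `x`; its square norm is
  -- `B x x` times the Gram determinant.
  have hv : B (B x x • y - B x y • x) (B x x • y - B x y • x) = 0 := by
    simp only [map_sub, map_smul, sub_apply, smul_apply, smul_eq_mul, hsymm y x]
    linear_combination B x x * h0
  have hv0 : B x x • y - B x y • x = 0 := by
    by_contra hne
    refine hdef _ ?_ hne hv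
    exact sub_mem (Submodule.smul_mem _ _ (Submodule.subset_span (by simp)))
      (Submodule.smul_mem _ _ (Submodule.subset_span (by simp)))
  refine hxx (LinearIndependent.pair_iff.1 hli (-B x y) (B x x) ?_).2
  rw [← hv0]
  module

end Signature

/-! ### Linear algebra of square-zero and rank-two operators. -/

section SquareZero

variable {K E F : Type*} [Field K] [AddCommGroup E] [Module K E]
  [AddCommGroup F] [Module K F]

/-- The normal form of a square-zero endomorphism. -/
lemma exists_equiv_of_comp_self_eq_zero [FiniteDimensional K E] {T : E →ₗ[K] E}
    (hT : ∀ v, T (T v) = 0) {r : ℕ} (hr : Module.finrank K T.range = r) :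
    ∃ Φ : ((Fin r → K) × (Fin r → K) × (Fin (Module.finrank K E - 2 * r) → K)) ≃ₗ[K] E,
      ∀ a c d, T (Φ (a, c, d)) = Φ (0, a, 0) := by
  -- With a section `s` of `T` over its range and a complement `C` of the range, `E` splits as
  -- `s(range) ⊕ range ⊕ (C ∩ ker)`, and `T` maps the first summand onto the second and kills the
  -- other two.
  obtain ⟨s, hs⟩ := T.rangeRestrict.exists_rightInverse_of_surjective T.range_rangeRestrict
  have hs' : ∀ a : T.range, T (s a) = a := fun a =>
    congrArg Subtype.val (LinearMap.congr_fun hs a)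
  obtain ⟨C, hC⟩ := T.range.exists_isCompl
  have hle : T.range ≤ T.ker := by
    rintro _ ⟨v, rfl⟩
    exact hT v
  -- The modular law, applicable because the range lies in the kernel.
  have hsup : T.range ⊔ C ⊓ T.ker = T.ker := by
    rw [← sup_inf_assoc_of_le C hle, hC.sup_eq_top, top_inf_eq]
  have hinf : T.range ⊓ (C ⊓ T.ker) = ⊥ := by
    rw [← inf_assoc, hC.inf_eq_bot, bot_inf_eq]
  have h1 := Submodule.finrank_sup_add_finrank_inf_eq T.range (C ⊓ T.ker)
  rw [hsup, hinf, finrank_bot] at h1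
  have h2 := T.finrank_range_add_finrank_ker
  have eR : (Fin r → K) ≃ₗ[K] T.range := LinearEquiv.ofFinrankEq _ _ (by simp [hr])
  have eD : (Fin (Module.finrank K E - 2 * r) → K) ≃ₗ[K] (C ⊓ T.ker : Submodule K E) :=
    LinearEquiv.ofFinrankEq _ _ (by simp only [Module.finrank_fin_fun]; lia)
  let φ : ((Fin r → K) × (Fin r → K) × (Fin (Module.finrank K E - 2 * r) → K)) →ₗ[K] E :=
    (s ∘ₗ eR.toLinearMap).coprod ((T.range.subtype ∘ₗ eR.toLinearMap).coprod
      ((C ⊓ T.ker).subtype ∘ₗ eD.toLinearMap))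
  have hφ : ∀ a c d, φ (a, c, d) = s (eR a) + (eR c + eD d) := fun a c d => rfl
  have hTφ : ∀ a c d, T (φ (a, c, d)) = φ (0, a, 0) := by
    intro a c d
    have hc : T (eR c) = 0 := hle (eR c).2
    have hd : T (eD d) = 0 := (eD d).2.2
    simp [hφ, hs', hc, hd]
  have hinj : Function.Injective φ := by
    refine (injective_iff_map_eq_zero _).2 ?_
    rintro ⟨a, c, d⟩ h
    have ha : a = 0 := by
      have := hTφ a c d
      rw [h, map_zero, hφ] at this
      simpa using this.symm
    subst ha
    have hsum : (eR c : E) + eD d = 0 := by simpa [hφ] using h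
    have hmem : (eR c : E) ∈ T.range ⊓ (C ⊓ T.ker) := by
      refine ⟨(eR c).2, ?_⟩
      rw [eq_neg_of_add_eq_zero_left hsum]
      exact neg_mem (eD d).2
    rw [hinf, Submodule.mem_bot] at hmem
    rw [hmem, zero_add] at hsum
    have hc : c = 0 := by simpa using hmem
    have hd : d = 0 := by simpa using hsum
    simp [hc, hd]
  refine ⟨LinearMap.linearEquivOfInjective φ hinj ?_, hTφ⟩
  simp only [Module.finrank_prod, Module.finrank_fin_fun]
  lia

/-- Square-zero endomorphisms of the same rank are conjugate. -/
lemma exists_conj_of_comp_self_eq_zero [FiniteDimensional K E] {T T' : E →ₗ[K] E}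
    (hT : ∀ v, T (T v) = 0) (hT' : ∀ v, T' (T' v) = 0)
    (hr : Module.finrank K T.range = Module.finrank K T'.range) :
    ∃ Θ : E ≃ₗ[K] E, ∀ v, T v = Θ (T' (Θ.symm v)) := by
  obtain ⟨Φ, hΦ⟩ := exists_equiv_of_comp_self_eq_zero hT rfl
  obtain ⟨Ψ, hΨ⟩ := exists_equiv_of_comp_self_eq_zero hT' hr.symm
  -- Both operators become the same shift `(a, c, d) ↦ (0, a, 0)` on the model space, so passing
  -- through it conjugates one to the other.
  refine ⟨Ψ.symm.trans Φ, fun v => ?_⟩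
  obtain ⟨⟨a, c, d⟩, rfl⟩ := Φ.surjective v
  simp [hΦ, hΨ]

/-- Two linearly independent functionals are jointly surjective. -/
lemma exists_apply_eq_of_linearIndependent {φ ψ : E →ₗ[K] K} (h : LinearIndependent K ![φ, ψ])
    (s t : K) : ∃ z, φ z = s ∧ ψ z = t := by
  have key : ∀ {φ ψ : E →ₗ[K] K}, LinearIndependent K ![φ, ψ] → ∃ z, φ z = 1 ∧ ψ z = 0 := by
    intro φ ψ h
    by_contra! hne
    -- If no such `z` exists, `φ` vanishes on the kernel of `ψ` and is therefore a multiple of `ψ`.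
    have hker : ⨅ _ : Unit, ψ.ker ≤ φ.ker := by
      intro z hz
      have hz : ψ z = 0 := by simpa using hz
      by_contra hφ
      have hφ : φ z ≠ 0 := hφ
      refine hne ((φ z)⁻¹ • z) (by simp [hφ]) (by simp [hz])
    have hmem := mem_span_of_iInf_ker_le_ker (L := fun _ : Unit => ψ) hker
    rw [Set.range_const, Submodule.mem_span_singleton] at hmem
    obtain ⟨c, hc⟩ := hmem
    refine one_ne_zero (LinearIndependent.pair_iff.1 h 1 (-c) ?_).1
    rw [← hc]
    module
  obtain ⟨z, hz1, hz2⟩ := key h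
  obtain ⟨z', hz1', hz2'⟩ := key (LinearIndependent.pair_symm_iff.1 h)
  exact ⟨s • z + t • z', by simp [hz1, hz2'], by simp [hz2, hz1']⟩

/-- The operator `z ↦ φ z • a - ψ z • c` has rank two if `φ, ψ` and `a, c` are independent. -/
lemma finrank_range_smulRight_sub {φ ψ : E →ₗ[K] K} (h : LinearIndependent K ![φ, ψ]) {a c : F}
    (hac : LinearIndependent K ![a, c]) :
    Module.finrank K (φ.smulRight a - ψ.smulRight c).range = 2 := by
  have hrange : (φ.smulRight a - ψ.smulRight c).range = Submodule.span K {a, c} := by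
    ext v
    rw [LinearMap.mem_range, Submodule.mem_span_pair]
    constructor
    · rintro ⟨z, rfl⟩
      exact ⟨φ z, -ψ z, by simp [sub_eq_add_neg]⟩
    · rintro ⟨s, t, rfl⟩
      obtain ⟨z, hz1, hz2⟩ := exists_apply_eq_of_linearIndependent h s (-t)
      exact ⟨z, by simp [hz1, hz2]⟩
  have := finrank_span_eq_card hac
  rw [Matrix.range_cons_cons_empty, Fintype.card_fin] at this
  rw [hrange, this]

end SquareZero

end JordanIP

namespace JordanIP

/-! ### The neutral form, its isotropic subspace and the ambient form. -/

section NeutralForm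

variable {p : ℕ} {V : Type*} [NormedAddCommGroup V] [NormedSpace ℝ V]
  (b : Module.Basis (Fin p ⊕ Fin p) ℝ V)

/-- The projection `v ↦ (x̃¹(v), …, x̃ᵖ(v))`. -/
noncomputable def tildeProj : V →L[ℝ] (Fin p → ℝ) :=
  ContinuousLinearMap.pi fun i => (ContinuousLinearMap.proj (Sum.inr i)).comp
    b.equivFunL.toContinuousLinearMap

@[simp]
lemma tildeProj_apply (v : V) (i : Fin p) : tildeProj b v i = b.repr v (Sum.inr i) := by
  simp [tildeProj, Module.Basis.equivFunL]

/-- The vector in the span of `e₁, …, e_p` dual to a functional of the coordinates `x̃`. -/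
noncomputable def dualLift : ((Fin p → ℝ) →L[ℝ] ℝ) →L[ℝ] V :=
  ∑ i, (ContinuousLinearMap.apply ℝ ℝ (Pi.single i 1 : Fin p → ℝ)).smulRight (b (Sum.inl i))

lemma dualLift_apply (β : (Fin p → ℝ) →L[ℝ] ℝ) :
    dualLift b β = ∑ i, β (Pi.single i 1) • b (Sum.inl i) := by
  simp [dualLift]

@[simp]
lemma tildeProj_dualLift (β : (Fin p → ℝ) →L[ℝ] ℝ) : tildeProj b (dualLift b β) = 0 := by
  ext i
  simp [dualLift_apply]

lemma repr_dualLift_inl (β : (Fin p → ℝ) →L[ℝ] ℝ) (i : Fin p) :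
    b.repr (dualLift b β) (Sum.inl i) = β (Pi.single i 1) := by
  simp [dualLift_apply, Finsupp.single_apply]

lemma sum_repr_inr_mul (β : (Fin p → ℝ) →L[ℝ] ℝ) (z : V) :
    ∑ i, β (Pi.single i 1) * b.repr z (Sum.inr i) = β (tildeProj b z) := by
  conv_rhs => rw [pi_eq_sum_univ' (tildeProj b z), map_sum]
  refine Finset.sum_congr rfl fun i _ => ?_
  rw [map_smul, tildeProj_apply, smul_eq_mul, mul_comm]

lemma neutralForm_symm (x y : V) : neutralForm b x y = neutralForm b y x := by
  rw [neutralForm_apply, neutralForm_apply]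
  exact Finset.sum_congr rfl fun i _ => by ring

/-- The lift has only `e`-coordinates, and these pair only with tilde coordinates. -/
lemma neutralForm_dualLift (β : (Fin p → ℝ) →L[ℝ] ℝ) (z : V) :
    neutralForm b (dualLift b β) z = β (tildeProj b z) := by
  rw [neutralForm_apply, ← sum_repr_inr_mul]
  refine Finset.sum_congr rfl fun i _ => ?_
  rw [repr_dualLift_inl, ← tildeProj_apply, ← tildeProj_apply b, tildeProj_dualLift]
  simp

/-- The kernel of `tildeProj` is the totally isotropic span of the `e i`. This gives both the norm
of the normal and the injectivity of `tildeProj` on definite planes. -/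
lemma neutralForm_eq_zero_of_tildeProj {x : V} (hx : tildeProj b x = 0) :
    neutralForm b x x = 0 := by
  have h : ∀ i, b.repr x (Sum.inr i) = 0 := fun i => by rw [← tildeProj_apply, hx, Pi.zero_apply]
  simp [neutralForm_apply, h]

lemma eq_zero_of_neutralForm_eq_zero {x : V} (hx : neutralForm b x = 0) : x = 0 := by
  apply b.repr.injective
  ext (i | i)
  · have := congrArg (fun α => α (b (Sum.inr i))) hx
    simpa [neutralForm_apply, Finsupp.single_apply] using this
  · have := congrArg (fun α => α (b (Sum.inl i))) hx
    simpa [neutralForm_apply, Finsupp.single_apply] using this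

lemma dualLift_injective : Function.Injective (dualLift b) := by
  refine (injective_iff_map_eq_zero _).2 fun β hβ => ?_
  ext v
  conv_lhs => rw [pi_eq_sum_univ' v, map_sum]
  refine Finset.sum_eq_zero fun i _ => ?_
  rw [map_smul, ← repr_dualLift_inl b, hβ]
  simp

/-- Coordinates diagonalizing the neutral form. -/
noncomputable def neutralCoord : V →ₗ[ℝ] Fin p ⊕ Fin p → ℝ :=
  LinearMap.pi (Sum.elim (fun i => b.coord (Sum.inl i) + b.coord (Sum.inr i))
    fun i => b.coord (Sum.inl i) - b.coord (Sum.inr i))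

lemma neutralCoord_injective : Function.Injective (neutralCoord b) := by
  refine (injective_iff_map_eq_zero _).2 fun v hv => ?_
  have h1 : ∀ i, b.repr v (Sum.inl i) + b.repr v (Sum.inr i) = 0 := fun i => by
    simpa [neutralCoord] using congrFun hv (Sum.inl i)
  have h2 : ∀ i, b.repr v (Sum.inl i) - b.repr v (Sum.inr i) = 0 := fun i => by
    simpa [neutralCoord] using congrFun hv (Sum.inr i)
  apply b.repr.injective
  ext (i | i) <;> rw [map_zero, Finsupp.zero_apply] <;> linarith [h1 i, h2 i]

/-- Each coordinate pair contributes `2st = ½(s + t)² - ½(s - t)²`. -/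
lemma neutralForm_self (v : V) : neutralForm b v v =
    ∑ i, Sum.elim (fun _ => (1 / 2 : ℝ)) (fun _ => -1 / 2) i *
      (neutralCoord b v i * neutralCoord b v i) := by
  rw [Fintype.sum_sum_type, ← Finset.sum_add_distrib, neutralForm_apply]
  refine Finset.sum_congr rfl fun i _ => ?_
  simp [neutralCoord]
  ring

lemma hasSignature_neutralForm : HasSignature (neutralForm b) p p := by
  have : FiniteDimensional ℝ V := b.finiteDimensional_of_finite
  have h := HasSignature.of_weightedSumSquares _ (neutralCoord b) (neutralCoord_injective b)
    (Module.finrank_eq_card_basis b) (neutralForm_symm b) (neutralForm_self b)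
    (by rintro (i | i) <;> norm_num)
  have hneg : {i : Fin p ⊕ Fin p | Sum.elim (fun _ => (1 / 2 : ℝ)) (fun _ => -1 / 2) i < 0} =
      Set.range Sum.inr := by
    ext (i | i) <;> norm_num <;> simp
  have hpos : {i : Fin p ⊕ Fin p | 0 < Sum.elim (fun _ => (1 / 2 : ℝ)) (fun _ => -1 / 2) i} =
      Set.range Sum.inl := by
    ext (i | i) <;> norm_num <;> simp
  rw [hneg, hpos, Set.ncard_range_of_injective Sum.inr_injective,
    Set.ncard_range_of_injective Sum.inl_injective] at h
  simpa using h

lemma ambientForm_apply (x y : V × ℝ) :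
    ambientForm b x y = neutralForm b x.1 y.1 + x.2 * y.2 := by
  simp [ambientForm, directSumForm]

lemma ambientForm_symm (x y : V × ℝ) : ambientForm b x y = ambientForm b y x := by
  rw [ambientForm_apply, ambientForm_apply, neutralForm_symm, mul_comm]

lemma hasSignature_ambientForm : HasSignature (ambientForm b) p (p + 1) := by
  have : FiniteDimensional ℝ V := b.finiteDimensional_of_finite
  let e : V × ℝ →ₗ[ℝ] Option (Fin p ⊕ Fin p) → ℝ :=
    LinearMap.pi fun i => i.elim (LinearMap.snd ℝ V ℝ)
      fun j => LinearMap.proj j ∘ₗ neutralCoord b ∘ₗ LinearMap.fst ℝ V ℝ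
  let w : Option (Fin p ⊕ Fin p) → ℝ := fun i =>
    i.elim 1 (Sum.elim (fun _ => (1 / 2 : ℝ)) (fun _ => -1 / 2))
  have he : Function.Injective e := by
    refine (injective_iff_map_eq_zero _).2 ?_
    rintro ⟨v, t⟩ h
    have ht : t = 0 := congrFun h none
    have hv : neutralCoord b v = 0 := funext fun j => congrFun h (some j)
    rw [neutralCoord_injective b (hv.trans (map_zero _).symm), ht]
    rfl
  have h := HasSignature.of_weightedSumSquares (B := ambientForm b) w e he
    (by simp [Module.finrank_eq_card_basis b]) (ambientForm_symm b)
    (fun x => by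
      rw [ambientForm_apply, neutralForm_self, Fintype.sum_option, add_comm]
      simp [w, e])
    (by rintro (_ | i | i) <;> norm_num [w])
  have hneg : {i | w i < 0} = Set.range fun i : Fin p => some (Sum.inr i) := by
    ext (_ | i | i) <;> norm_num [w] <;> simp
  have hpos : {i | 0 < w i} = Set.range fun i : Option (Fin p) => i.map Sum.inl := by
    ext (_ | i | i)
    · simp [w]
    · simp [w]
    · norm_num [w]
      simp
  rw [hneg, hpos, Set.ncard_range_of_injective (f := fun i : Fin p => some (Sum.inr i))
    ((Option.some_injective _).comp Sum.inr_injective), Set.ncard_range_of_injective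
    (Option.map_injective Sum.inl_injective)] at h
  simpa using h

end NeutralForm

/-! ### Differential, metric and connection of the graph. -/

section GraphGeometry

variable {p : ℕ} {V : Type*} [NormedAddCommGroup V] [NormedSpace ℝ V]
  (b : Module.Basis (Fin p ⊕ Fin p) ℝ V) {f : (Fin p → ℝ) → ℝ}

lemma graphMap_eq (f : (Fin p → ℝ) → ℝ) : graphMap b f = fun v => (v, f (tildeProj b v)) := by
  funext v
  simp only [graphMap]
  congr 2

lemma contDiff_graphMap (hf : ContDiff ℝ ∞ f) : ContDiff ℝ ∞ (graphMap b f) := by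
  rw [graphMap_eq]
  exact contDiff_id.prodMk (hf.comp (tildeProj b).contDiff)

lemma isEmbedding_graphMap (hf : Continuous f) : Topology.IsEmbedding (graphMap b f) := by
  refine Function.LeftInverse.isEmbedding (f := Prod.fst) (fun v => rfl) continuous_fst ?_
  rw [graphMap_eq]
  fun_prop

/-- The differential of the graph map. -/
lemma fderiv_graphMap (hf : ContDiff ℝ ∞ f) : fderiv ℝ (graphMap b f) = fun P =>
    (ContinuousLinearMap.id ℝ V).prod ((fderiv ℝ f (tildeProj b P)).comp (tildeProj b)) := by
  funext P
  rw [graphMap_eq]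
  have h : HasFDerivAt f (fderiv ℝ f (tildeProj b P)) (tildeProj b P) :=
    (hf.differentiable (by simp) _).hasFDerivAt
  exact ((hasFDerivAt_id P).prodMk (h.comp P (tildeProj b).hasFDerivAt)).fderiv

lemma fderiv_graphMap_apply (hf : ContDiff ℝ ∞ f) (P x : V) :
    fderiv ℝ (graphMap b f) P x = (x, fderiv ℝ f (tildeProj b P) (tildeProj b x)) := by
  rw [fderiv_graphMap b hf]
  rfl

lemma contDiff_fderiv {E G : Type*} [NormedAddCommGroup E] [NormedSpace ℝ E]
    [NormedAddCommGroup G] [NormedSpace ℝ G] {h : E → G} (hf : ContDiff ℝ ∞ h) :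
    ContDiff ℝ ∞ (fderiv ℝ h) :=
  hf.fderiv_right (by simp)

lemma fderiv_fderiv_symm {E G : Type*} [NormedAddCommGroup E] [NormedSpace ℝ E]
    [NormedAddCommGroup G] [NormedSpace ℝ G] {h : E → G} (hf : ContDiff ℝ ∞ h) (w u v : E) :
    fderiv ℝ (fderiv ℝ h) w u v = fderiv ℝ (fderiv ℝ h) w v u :=
  ((contDiff_infty.1 hf 2).contDiffAt.isSymmSndFDerivAt (by simp)).eq u v

lemma fderiv_fderiv_fderiv_symm (hf : ContDiff ℝ ∞ f) (w u v : Fin p → ℝ) :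
    fderiv ℝ (fderiv ℝ (fderiv ℝ f)) w u v = fderiv ℝ (fderiv ℝ (fderiv ℝ f)) w v u :=
  fderiv_fderiv_symm (contDiff_fderiv hf) w u v

/-- The derivative along `V` of a function of the coordinates `x̃`. -/
lemma fderiv_comp_tildeProj {G : Type*} [NormedAddCommGroup G] [NormedSpace ℝ G]
    {h : (Fin p → ℝ) → G} (hh : ContDiff ℝ ∞ h) (P u : V) :
    fderiv ℝ (fun Q => h (tildeProj b Q)) P u = fderiv ℝ h (tildeProj b P) (tildeProj b u) := by
  have h' : HasFDerivAt h (fderiv ℝ h (tildeProj b P)) (tildeProj b P) :=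
    (hh.differentiable (by simp) _).hasFDerivAt
  have hcomp : HasFDerivAt (fun Q => h (tildeProj b Q)) _ P :=
    h'.comp P (tildeProj b).hasFDerivAt
  rw [hcomp.fderiv]
  rfl

/-- The second derivative of the graph map. -/
lemma fderiv_fderiv_graphMap_apply (hf : ContDiff ℝ ∞ f) (P x y : V) :
    fderiv ℝ (fderiv ℝ (graphMap b f)) P x y =
      (0, fderiv ℝ (fderiv ℝ f) (tildeProj b P) (tildeProj b x) (tildeProj b y)) := by
  have hd : DifferentiableAt ℝ (fderiv ℝ (graphMap b f)) P :=
    ((contDiff_graphMap b hf).fderiv_right (m := ∞) (by simp)).differentiable (by simp) P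
  have h1 : fderiv ℝ (fun Q => fderiv ℝ (graphMap b f) Q y) P x =
      fderiv ℝ (fderiv ℝ (graphMap b f)) P x y := by
    rw [(hd.hasFDerivAt.clm_apply (hasFDerivAt_const y P)).fderiv]
    simp
  have h2 : (fun Q => fderiv ℝ (graphMap b f) Q y) =
      fun Q => (y, (fun w => fderiv ℝ f w (tildeProj b y)) (tildeProj b Q)) := by
    funext Q
    rw [fderiv_graphMap_apply b hf]
  have hc : ContDiff ℝ ∞ fun w => fderiv ℝ f w (tildeProj b y) :=
    (contDiff_fderiv hf).clm_apply contDiff_const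
  have hc' : DifferentiableAt ℝ (fun Q => (fun w => fderiv ℝ f w (tildeProj b y))
      (tildeProj b Q)) P := (hc.comp (tildeProj b).contDiff).differentiable (by simp) P
  rw [← h1, h2, ((hasFDerivAt_const y P).prodMk hc'.hasFDerivAt).fderiv]
  rw [ContinuousLinearMap.prod_apply, fderiv_comp_tildeProj b hc]
  have hd' := ((contDiff_fderiv hf).differentiable (by simp) (tildeProj b P)).hasFDerivAt
  rw [(hd'.clm_apply (hasFDerivAt_const (tildeProj b y) _)).fderiv]
  simp

/-- The vector field `a` dual to `df`. -/
noncomputable def gradLift (f : (Fin p → ℝ) → ℝ) (P : V) : V :=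
  dualLift b (fderiv ℝ f (tildeProj b P))

@[simp]
lemma tildeProj_gradLift (f : (Fin p → ℝ) → ℝ) (P : V) : tildeProj b (gradLift b f P) = 0 :=
  tildeProj_dualLift b _

lemma contDiff_gradLift (hf : ContDiff ℝ ∞ f) : ContDiff ℝ ∞ (gradLift b f) :=
  (dualLift b).contDiff.comp ((contDiff_fderiv hf).comp (tildeProj b).contDiff)

lemma graphMetric_apply (hf : ContDiff ℝ ∞ f) (P x y : V) : graphMetric b f P x y =
    neutralForm b x y + fderiv ℝ f (tildeProj b P) (tildeProj b x) *
      fderiv ℝ f (tildeProj b P) (tildeProj b y) := by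
  simp [graphMetric, inducedMetric, fderiv_graphMap_apply b hf, ambientForm_apply]

lemma graphMetric_symm (hf : ContDiff ℝ ∞ f) (P x y : V) :
    graphMetric b f P x y = graphMetric b f P y x := by
  rw [graphMetric_apply b hf, graphMetric_apply b hf, neutralForm_symm, mul_comm]

/-- Lifts project to zero, so the `df ⊗ df` term does not see them. The musical isomorphism is thus
explicit on functionals that factor through `tildeProj`, and the same at every point. -/
lemma graphMetric_dualLift (hf : ContDiff ℝ ∞ f) (P : V) (β : (Fin p → ℝ) →L[ℝ] ℝ) (z : V) :
    graphMetric b f P (dualLift b β) z = β (tildeProj b z) := by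
  simp [graphMetric_apply b hf, neutralForm_dualLift]

lemma contDiff_graphMetric (hf : ContDiff ℝ ∞ f) : ContDiff ℝ ∞ (graphMetric b f) := by
  have h : graphMetric b f = fun P => neutralForm b +
      ContinuousLinearMap.smulRightL ℝ V (V →L[ℝ] ℝ)
        ((fderiv ℝ f (tildeProj b P)).comp (tildeProj b))
        ((fderiv ℝ f (tildeProj b P)).comp (tildeProj b)) := by
    funext P
    ext x y
    simp [graphMetric_apply b hf]
  rw [h]
  have hα : ContDiff ℝ ∞ fun P => (fderiv ℝ f (tildeProj b P)).comp (tildeProj b) :=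
    ((contDiff_fderiv hf).comp (tildeProj b).contDiff).clm_comp contDiff_const
  exact contDiff_const.add ((contDiff_const.clm_apply hα).clm_apply hα)

lemma graphMetric_nondegenerate (hf : ContDiff ℝ ∞ f) (P x : V) (hx : graphMetric b f P x = 0) :
    x = 0 := by
  -- Pairing with the lifts of the coordinate functionals detects the projection of `x`; once it is
  -- zero, `g` reduces to the neutral form on `x`.
  have hπ : tildeProj b x = 0 := by
    ext i
    have h := graphMetric_dualLift b hf P (ContinuousLinearMap.proj i) x
    rw [graphMetric_symm b hf, hx] at h
    simpa using h.symm
  apply eq_zero_of_neutralForm_eq_zero b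
  ext y
  have h := congrArg (fun α => α y) hx
  simpa [graphMetric_apply b hf, hπ] using h

lemma isInvertible_graphMetric (hf : ContDiff ℝ ∞ f) (P : V) :
    (graphMetric b f P).IsInvertible := by
  have : FiniteDimensional ℝ V := b.finiteDimensional_of_finite
  exact isInvertible_of_nondegenerate (graphMetric_nondegenerate b hf P)

lemma eq_of_graphMetric_apply_eq (hf : ContDiff ℝ ∞ f) (P : V) {x y : V}
    (h : ∀ z, graphMetric b f P x z = graphMetric b f P y z) : x = y := by
  rw [← sub_eq_zero]
  apply graphMetric_nondegenerate b hf P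
  ext z
  simp [h z]

/-- With `α = df ∘ π` and `a` its lift, `x ↦ x + ½ α(x) a` carries `g` to the neutral form: the two
cross terms add up to `α(x) α(y)`, and `(a, a) = α(a) = 0`. For the same reason the inverse has `-½`
in place of `½`. -/
lemma hasSignature_graphMetric (hf : ContDiff ℝ ∞ f) (P : V) :
    HasSignature (graphMetric b f P) p p := by
  let α : V →ₗ[ℝ] ℝ := ((fderiv ℝ f (tildeProj b P)).comp (tildeProj b) : V →L[ℝ] ℝ)
  have hα : ∀ x, α x = fderiv ℝ f (tildeProj b P) (tildeProj b x) := fun x => rfl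
  have hαa : α (gradLift b f P) = 0 := by simp [hα]
  let T (c : ℝ) : V →ₗ[ℝ] V := LinearMap.id + c • α.smulRight (gradLift b f P)
  have hT : ∀ c x, T c x = x + c • α x • gradLift b f P := fun c x => rfl
  refine (hasSignature_neutralForm b).of_isometry
    (LinearEquiv.ofLinearMap (T (1 / 2)) (T (-1 / 2)) ?_ ?_) fun x y => ?_
  · ext x
    simp only [LinearMap.comp_apply, hT, map_add, map_smul, hαa, LinearMap.id_apply]
    module
  · ext x
    simp only [LinearMap.comp_apply, hT, map_add, map_smul, hαa, LinearMap.id_apply]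
    module
  · rw [graphMetric_apply b hf, LinearEquiv.coe_ofLinearMap, hT, hT]
    have h1 : ∀ z, neutralForm b (gradLift b f P) z = α z := neutralForm_dualLift b _
    simp only [map_add, map_smul, add_apply, smul_apply, smul_eq_mul, h1, hαa,
      neutralForm_symm b x (gradLift b f P), ← hα]
    ring

lemma fderiv_graphMetric_apply (hf : ContDiff ℝ ∞ f) (P u x y : V) :
    fderiv ℝ (graphMetric b f) P u x y =
      fderiv ℝ (fderiv ℝ f) (tildeProj b P) (tildeProj b u) (tildeProj b x) *
          fderiv ℝ f (tildeProj b P) (tildeProj b y) +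
        fderiv ℝ f (tildeProj b P) (tildeProj b x) *
          fderiv ℝ (fderiv ℝ f) (tildeProj b P) (tildeProj b u) (tildeProj b y) := by
  have hg := ((contDiff_graphMetric b hf).differentiable (by simp) P).hasFDerivAt
  have h1 : fderiv ℝ (fun Q => graphMetric b f Q x y) P u =
      fderiv ℝ (graphMetric b f) P u x y := by
    rw [((hg.clm_apply (hasFDerivAt_const x P)).clm_apply (hasFDerivAt_const y P)).fderiv]
    simp
  have h2 : (fun Q => graphMetric b f Q x y) = fun Q => (fun w => neutralForm b x y +
      fderiv ℝ f w (tildeProj b x) * fderiv ℝ f w (tildeProj b y)) (tildeProj b Q) := by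
    funext Q
    rw [graphMetric_apply b hf]
  have hc : ∀ v, ContDiff ℝ ∞ fun w => fderiv ℝ f w v := fun v =>
    (contDiff_fderiv hf).clm_apply contDiff_const
  have hd := ((contDiff_fderiv hf).differentiable (by simp) (tildeProj b P)).hasFDerivAt
  have hd' : ∀ v, HasFDerivAt (fun w => fderiv ℝ f w v) _ (tildeProj b P) := fun v =>
    hd.clm_apply (hasFDerivAt_const v (tildeProj b P))
  have hsum : HasFDerivAt (fun w => neutralForm b x y +
      fderiv ℝ f w (tildeProj b x) * fderiv ℝ f w (tildeProj b y)) _ (tildeProj b P) :=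
    ((hd' (tildeProj b x)).mul (hd' (tildeProj b y))).const_add (neutralForm b x y)
  rw [← h1, h2, fderiv_comp_tildeProj b (contDiff_const.add ((hc _).mul (hc _))),
    hsum.fderiv]
  simp
  ring

/-- The Christoffel symbols of the graph. -/
lemma christoffel_graphMetric (hf : ContDiff ℝ ∞ f) (P x y : V) :
    christoffel (graphMetric b f) P x y =
      fderiv ℝ (fderiv ℝ f) (tildeProj b P) (tildeProj b x) (tildeProj b y) •
        gradLift b f P := by
  apply eq_of_graphMetric_apply_eq b hf P
  intro z
  -- In the Koszul formula the symmetry of `H` leaves only `H(πx, πy) df(πz)`, which is the pairing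
  -- of `H(πx, πy) a` with `z`.
  rw [apply_christoffel (isInvertible_graphMetric b hf P), fderiv_graphMetric_apply b hf,
    fderiv_graphMetric_apply b hf, fderiv_graphMetric_apply b hf, map_smul, smul_apply, gradLift,
    graphMetric_dualLift b hf, fderiv_fderiv_symm hf _ (tildeProj b y) (tildeProj b x),
    fderiv_fderiv_symm hf _ (tildeProj b z) (tildeProj b x),
    fderiv_fderiv_symm hf _ (tildeProj b z) (tildeProj b y), smul_eq_mul]
  ring

lemma contDiff_christoffel_graphMetric (hf : ContDiff ℝ ∞ f) :
    ContDiff ℝ ∞ (christoffel (graphMetric b f)) := by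
  -- The pointwise formula is recast as a composition of continuous multilinear operations, to
  -- obtain smoothness as an operator-valued map.
  have h : christoffel (graphMetric b f) = fun P =>
      ((ContinuousLinearMap.smulRightL ℝ V V).flip (gradLift b f P)).comp
        ((fderiv ℝ (fderiv ℝ f) (tildeProj b P)).bilinearComp (tildeProj b) (tildeProj b)) := by
    funext P
    ext x y
    simp [christoffel_graphMetric b hf]
  rw [h]
  have h1 : ContDiff ℝ ∞ fun P => (fderiv ℝ (fderiv ℝ f) (tildeProj b P)).bilinearComp
      (tildeProj b) (tildeProj b) := by
    have h2 : (fun P => (fderiv ℝ (fderiv ℝ f) (tildeProj b P)).bilinearComp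
        (tildeProj b) (tildeProj b)) = fun P =>
        ((ContinuousLinearMap.compL ℝ V (Fin p → ℝ) ℝ).flip (tildeProj b)).comp
          ((fderiv ℝ (fderiv ℝ f) (tildeProj b P)).comp (tildeProj b)) := by
      funext P
      ext x y
      simp
    rw [h2]
    exact contDiff_const.clm_comp
      (((contDiff_fderiv (contDiff_fderiv hf)).comp (tildeProj b).contDiff).clm_comp
        contDiff_const)
  exact (contDiff_const.clm_apply (contDiff_gradLift b hf)).clm_comp h1

/-! ### Shape operator, Gauss equation and unit normals. -/

/-- The shape operator of the graph with respect to the normal `(-a, 1)`. -/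
noncomputable def hessLift (f : (Fin p → ℝ) → ℝ) (P : V) : V →L[ℝ] V :=
  dualLift b ∘L fderiv ℝ (fderiv ℝ f) (tildeProj b P) ∘L tildeProj b

lemma hessLift_apply (f : (Fin p → ℝ) → ℝ) (P x : V) : hessLift b f P x =
    dualLift b (fderiv ℝ (fderiv ℝ f) (tildeProj b P) (tildeProj b x)) := rfl

lemma graphMetric_hessLift (hf : ContDiff ℝ ∞ f) (P x z : V) :
    graphMetric b f P (hessLift b f P x) z =
      fderiv ℝ (fderiv ℝ f) (tildeProj b P) (tildeProj b x) (tildeProj b z) :=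
  graphMetric_dualLift b hf P _ z

lemma hessLift_hessLift (f : (Fin p → ℝ) → ℝ) (P x : V) :
    hessLift b f P (hessLift b f P x) = 0 := by
  simp [hessLift_apply]

/-- The Gauss equation for the graph. -/
lemma graphCurvature_eq (hf : ContDiff ℝ ∞ f) (P : V) :
    graphCurvature b f P = curvatureOf (graphMetric b f P) (hessLift b f P) := by
  have hΓ := ((contDiff_christoffel_graphMetric b hf).differentiable (by simp) P).hasFDerivAt
  -- Product rule for `H(πx, πz) a`; the derivative of `a` along `u` is `hessLift b f P u`.
  have key : ∀ u x z, fderiv ℝ (christoffel (graphMetric b f)) P u x z =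
      fderiv ℝ (fderiv ℝ (fderiv ℝ f)) (tildeProj b P) (tildeProj b u) (tildeProj b x)
          (tildeProj b z) • gradLift b f P +
        fderiv ℝ (fderiv ℝ f) (tildeProj b P) (tildeProj b x) (tildeProj b z) •
          hessLift b f P u := by
    intro u x z
    have h1 : fderiv ℝ (fun Q => christoffel (graphMetric b f) Q x z) P u =
        fderiv ℝ (christoffel (graphMetric b f)) P u x z := by
      rw [((hΓ.clm_apply (hasFDerivAt_const x P)).clm_apply (hasFDerivAt_const z P)).fderiv]
      simp
    have h2 : (fun Q => christoffel (graphMetric b f) Q x z) = fun Q =>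
        (fun w => fderiv ℝ (fderiv ℝ f) w (tildeProj b x) (tildeProj b z) •
          dualLift b (fderiv ℝ f w)) (tildeProj b Q) := by
      funext Q
      rw [christoffel_graphMetric b hf, gradLift]
    have hf1 := contDiff_fderiv hf
    have hf2 := contDiff_fderiv hf1
    have hs : ContDiff ℝ ∞ fun w => fderiv ℝ (fderiv ℝ f) w (tildeProj b x) (tildeProj b z) :=
      (hf2.clm_apply contDiff_const).clm_apply contDiff_const
    have hl : ContDiff ℝ ∞ fun w => dualLift b (fderiv ℝ f w) := (dualLift b).contDiff.comp hf1
    have hd1 := (hf1.differentiable (by simp) (tildeProj b P)).hasFDerivAt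
    have hd2 := (hf2.differentiable (by simp) (tildeProj b P)).hasFDerivAt
    have hds := (hd2.clm_apply (hasFDerivAt_const (tildeProj b x) (tildeProj b P))).clm_apply
      (hasFDerivAt_const (tildeProj b z) (tildeProj b P))
    have hdl := (dualLift b).hasFDerivAt.comp (tildeProj b P) hd1
    have hsl : ContDiff ℝ ∞ fun w => fderiv ℝ (fderiv ℝ f) w (tildeProj b x) (tildeProj b z) •
        dualLift b (fderiv ℝ f w) := hs.smul hl
    have hdsl : HasFDerivAt (fun w => fderiv ℝ (fderiv ℝ f) w (tildeProj b x) (tildeProj b z) •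
        dualLift b (fderiv ℝ f w)) _ (tildeProj b P) := hds.smul hdl
    rw [← h1, h2, fderiv_comp_tildeProj b hsl, hdsl.fderiv]
    simp [gradLift, hessLift_apply]
    abel
  funext x y
  ext z
  -- Third derivatives cancel by symmetry, products of Christoffel symbols vanish because `a`
  -- projects to zero, and the terms `H • hessLift` form `R_S`.
  simp only [graphCurvature, curvature, curvatureOf, add_apply, sub_apply, key,
    ContinuousLinearMap.comp_apply, christoffel_graphMetric b hf,
    ContinuousLinearMap.smulRight_apply,
    graphMetric_hessLift b hf, map_smul, tildeProj_gradLift, map_zero, smul_zero, zero_smul,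
    fderiv_fderiv_fderiv_symm hf _ (tildeProj b y) (tildeProj b x)]
  abel

/-- The unit normals of the graph. -/
lemma isUnitNormal_graphMap_iff (hf : ContDiff ℝ ∞ f) (P : V) (ν : V × ℝ) :
    IsUnitNormal (ambientForm b) (graphMap b f) P ν ↔
      ν.1 = -ν.2 • gradLift b f P ∧ ν.2 ^ 2 = 1 := by
  have hself : ∀ c : ℝ, neutralForm b (c • gradLift b f P) (c • gradLift b f P) = 0 := fun c =>
    neutralForm_eq_zero_of_tildeProj b (by simp)
  have hperp : (∀ x, ambientForm b (fderiv ℝ (graphMap b f) P x) ν = 0) ↔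
      ν.1 = -ν.2 • gradLift b f P := by
    -- The `ℝ`-component of the tangent vector is `df(πx) = (a, x)`, which moves into the neutral
    -- form and leaves a single vector to be tested against all `x`.
    have h : ∀ x, ambientForm b (fderiv ℝ (graphMap b f) P x) ν =
        neutralForm b (ν.1 + ν.2 • gradLift b f P) x := by
      intro x
      have h1 : neutralForm b (gradLift b f P) x = _ := neutralForm_dualLift b _ x
      rw [fderiv_graphMap_apply b hf, ambientForm_apply, map_add, add_apply, map_smul, smul_apply,
        h1, neutralForm_symm b ν.1, smul_eq_mul]
      ring
    simp only [h]
    rw [neg_smul, ← add_eq_zero_iff_eq_neg]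
    refine ⟨fun h => eq_zero_of_neutralForm_eq_zero b (ContinuousLinearMap.ext h), fun h => ?_⟩
    simp [h]
  rw [IsUnitNormal, hperp]
  refine and_congr_right fun h => ?_
  rw [ambientForm_apply, h, hself, zero_add, ← pow_two, abs_of_nonneg (sq_nonneg _)]

lemma ambientForm_self_of_isUnitNormal (hf : ContDiff ℝ ∞ f) {P : V} {ν : V × ℝ}
    (hν : IsUnitNormal (ambientForm b) (graphMap b f) P ν) : ambientForm b ν ν = 1 := by
  obtain ⟨h1, h2⟩ := (isUnitNormal_graphMap_iff b hf P ν).1 hν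
  have h0 : neutralForm b ν.1 ν.1 = 0 :=
    neutralForm_eq_zero_of_tildeProj b (by rw [h1, map_smul, tildeProj_gradLift, smul_zero])
  rw [ambientForm_apply, h0, zero_add, ← pow_two, h2]

/-- The second derivative of the graph map has only an `ℝ`-component, so the normal enters through
`ν.2` alone. -/
lemma graphShape_eq (hf : ContDiff ℝ ∞ f) (P : V) (ν : V × ℝ) :
    graphShape b f P ν = ν.2 • hessLift b f P := by
  ext x
  apply eq_of_graphMetric_apply_eq b hf P
  intro z
  have h : graphMetric b f P (graphShape b f P ν x) =
      secondFundamentalForm (ambientForm b) (graphMap b f) P ν x :=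
    apply_sharp (isInvertible_graphMetric b hf P) _
  rw [h, smul_apply, map_smul, smul_apply, graphMetric_hessLift b hf]
  simp [secondFundamentalForm, fderiv_fderiv_graphMap_apply b hf, ambientForm_apply, mul_comm]

/-- `R_φ` is quadratic in `φ`, so the choice of sign of the unit normal does not matter. -/
lemma curvatureOf_smul (B : V →L[ℝ] V →L[ℝ] ℝ) (φ : V →L[ℝ] V) {c : ℝ} (hc : c ^ 2 = 1) :
    curvatureOf B (c • φ) = curvatureOf B φ := by
  funext x y
  ext z
  simp only [curvatureOf, sub_apply, ContinuousLinearMap.smulRight_apply, smul_apply, map_smul,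
    smul_eq_mul, smul_smul]
  have h : ∀ t : ℝ, c * t * c = t := fun t => by linear_combination t * hc
  rw [h, h]

/-- `R(x, y)` takes values in the range of `S`, which projects to zero, while its coefficients
`H(πx, π·)` and `H(πy, π·)` factor through the projection. -/
lemma graphCurvature_comp_self (hf : ContDiff ℝ ∞ f) (P x y z : V) :
    graphCurvature b f P x y (graphCurvature b f P x y z) = 0 := by
  have h : ∀ u v, fderiv ℝ (fderiv ℝ f) (tildeProj b P) u (tildeProj b (hessLift b f P v)) = 0 :=
    fun u v => by rw [hessLift_apply, tildeProj_dualLift, map_zero]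
  simp [graphCurvature_eq b hf, curvatureOf, graphMetric_hessLift b hf, h]

/-! ### Rank and conjugacy of the curvature operators of definite planes. -/

/-- At points where the Hessian is nondegenerate, the second derivative is injective. -/
lemma fderiv_fderiv_injective (hf : ContDiff ℝ ∞ f) {w : Fin p → ℝ}
    (hw : (hessian f w).det ≠ 0) : Function.Injective (fderiv ℝ (fderiv ℝ f) w) := by
  refine (injective_iff_map_eq_zero _).2 fun v hv => ?_
  apply Matrix.eq_zero_of_vecMul_eq_zero hw
  funext j
  have hd := ((contDiff_fderiv hf).differentiable (by simp) w).hasFDerivAt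
  have hij : ∀ i, hessian f w i j =
      fderiv ℝ (fderiv ℝ f) w (Pi.single i 1) (Pi.single j 1) := by
    intro i
    rw [hessian, Matrix.of_apply, (hd.clm_apply (hasFDerivAt_const _ w)).fderiv]
    simp
  have hsum : fderiv ℝ (fderiv ℝ f) w v (Pi.single j 1) =
      ∑ i, v i * hessian f w i j := by
    conv_lhs => rw [pi_eq_sum_univ' v, map_sum]
    simp [hij]
  rw [hv] at hsum
  simpa [Matrix.vecMul, dotProduct] using hsum.symm

lemma continuous_det_hessian (hf : ContDiff ℝ ∞ f) : Continuous fun w => (hessian f w).det := by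
  refine Continuous.matrix_det (continuous_matrix fun i j => ?_)
  have h : ContDiff ℝ ∞ fun z => fderiv ℝ f z (Pi.single j 1) :=
    (contDiff_fderiv hf).clm_apply contDiff_const
  exact ((h.fderiv_right (m := ∞) (by simp)).clm_apply contDiff_const).continuous

/-- On a definite plane the projection to the coordinates `x̃` is injective. -/
lemma linearIndependent_tildeProj (hf : ContDiff ℝ ∞ f) {P x y : V}
    (hli : LinearIndependent ℝ ![x, y])
    (hdef : ∀ v ∈ Submodule.span ℝ {x, y}, v ≠ 0 → graphMetric b f P v v ≠ 0) :
    LinearIndependent ℝ ![tildeProj b x, tildeProj b y] := by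
  rw [LinearIndependent.pair_iff] at hli ⊢
  intro s t h
  rw [← map_smul, ← map_smul, ← map_add] at h
  apply hli
  by_contra hne
  -- A nonzero combination with zero projection would be a null vector of the definite plane.
  refine hdef _ (Submodule.mem_span_pair.2 ⟨s, t, rfl⟩) hne ?_
  rw [graphMetric_apply b hf, neutralForm_eq_zero_of_tildeProj b h, h, map_zero, mul_zero,
    add_zero]

/-- `S` preserves the independence of `x, y`, being injective in each of its three factors on this
plane; lowering indices by `g` preserves it again, so the rank-two lemma applies to `R_S(x, y)`. -/
lemma finrank_range_graphCurvature (hf : ContDiff ℝ ∞ f) {P x y : V}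
    (hP : (hessian f (tildeProj b P)).det ≠ 0) (hli : LinearIndependent ℝ ![x, y])
    (hdef : ∀ v ∈ Submodule.span ℝ {x, y}, v ≠ 0 → graphMetric b f P v v ≠ 0) :
    Module.finrank ℝ (graphCurvature b f P x y : V →ₗ[ℝ] V).range = 2 := by
  have : FiniteDimensional ℝ V := b.finiteDimensional_of_finite
  have hS : LinearIndependent ℝ ![hessLift b f P x, hessLift b f P y] := by
    have h := linearIndependent_tildeProj b hf hli hdef
    rw [LinearIndependent.pair_iff] at h ⊢
    intro s t hst
    apply h
    apply fderiv_fderiv_injective hf hP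
    apply dualLift_injective b
    simpa [hessLift_apply] using hst
  have hφ : LinearIndependent ℝ ![(graphMetric b f P (hessLift b f P y) : V →ₗ[ℝ] ℝ),
      (graphMetric b f P (hessLift b f P x) : V →ₗ[ℝ] ℝ)] := by
    have h := LinearIndependent.pair_symm_iff.1 hS
    rw [LinearIndependent.pair_iff] at h ⊢
    intro s t hst
    apply h
    apply graphMetric_nondegenerate b hf P
    ext z
    simpa using LinearMap.congr_fun hst z
  have h := finrank_range_smulRight_sub hφ hS
  rw [graphCurvature_eq b hf]
  exact h

/-- Curvature operators of definite planes have rank two and are conjugate. -/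
lemma skewCurvature_graph (hf : ContDiff ℝ ∞ f) {P x y : V}
    (hP : (hessian f (tildeProj b P)).det ≠ 0) (hli : LinearIndependent ℝ ![x, y])
    (hdef : ∀ v ∈ Submodule.span ℝ {x, y}, v ≠ 0 → graphMetric b f P v v ≠ 0) :
    Module.finrank ℝ (skewCurvature (graphMetric b f P) (graphCurvature b f P) x y :
        V →ₗ[ℝ] V).range = 2 ∧
      ∀ v, skewCurvature (graphMetric b f P) (graphCurvature b f P) x y
        (skewCurvature (graphMetric b f P) (graphCurvature b f P) x y v) = 0 := by
  -- Definiteness makes the normalizing factor a nonzero scalar, which changes neither the rank nor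
  -- the vanishing of the square.
  have hg := gram_ne_zero (graphMetric_symm b hf P) hli hdef
  have hc : (Real.sqrt |graphMetric b f P x x * graphMetric b f P y y -
      graphMetric b f P x y ^ 2|)⁻¹ ≠ 0 := by positivity
  refine ⟨?_, fun v => ?_⟩
  · rw [skewCurvature, ContinuousLinearMap.toLinearMap_smul, LinearMap.range_smul _ _ hc]
    exact finrank_range_graphCurvature b hf hP hli hdef
  · simp [skewCurvature, graphCurvature_comp_self b hf]

lemma graph_jordanIP (hf : ContDiff ℝ ∞ f) {P : V}
    (hP : (hessian f (tildeProj b P)).det ≠ 0) :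
    IsSpacelikeRankJordanIP (graphMetric b f P) (graphCurvature b f P) 2 ∧
      IsTimelikeRankJordanIP (graphMetric b f P) (graphCurvature b f P) 2 := by
  have : FiniteDimensional ℝ V := b.finiteDimensional_of_finite
  have hs {x y : V} (h : IsSpacelikePair (graphMetric b f P) x y) :=
    skewCurvature_graph b hf hP h.1 fun v hv hv0 => (h.2 v hv hv0).ne'
  have ht {x y : V} (h : IsTimelikePair (graphMetric b f P) x y) :=
    skewCurvature_graph b hf hP h.1 fun v hv hv0 => (h.2 v hv hv0).ne
  exact ⟨⟨fun x y h => (hs h).1, fun x y x' y' h h' => exists_conj_of_comp_self_eq_zero (hs h).2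
      (hs h').2 ((hs h).1.trans (hs h').1.symm)⟩,
    fun x y h => (ht h).1, fun x y x' y' h h' => exists_conj_of_comp_self_eq_zero (ht h).2
      (ht h').2 ((ht h).1.trans (ht h').1.symm)⟩

end GraphGeometry

end JordanIP

theorem lemma5p2 {p : ℕ} {V : Type*} [NormedAddCommGroup V] [NormedSpace ℝ V]
    (b : Module.Basis (Fin p ⊕ Fin p) ℝ V)
    (f : (Fin p → ℝ) → ℝ) (hf : ContDiff ℝ ∞ f)
    (hdf : fderiv ℝ f 0 = 0) (hHess : (hessian f 0).det ≠ 0) :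
    HasSignature (neutralForm b) p p ∧
    HasSignature (ambientForm b) p (p + 1) ∧
    (ContDiff ℝ ∞ (graphMap b f) ∧ Topology.IsEmbedding (graphMap b f) ∧
      ∀ P, Function.Injective (fderiv ℝ (graphMap b f) P)) ∧
    ∃ O : Set V, IsOpen O ∧ IsConnected O ∧ 0 ∈ O ∧
      IsPseudoRiemannianOn (graphMetric b f) O p p ∧
      (∀ P ∈ O,
        IsSpacelikeRankJordanIP (graphMetric b f P) (graphCurvature b f P) 2 ∧
        IsTimelikeRankJordanIP (graphMetric b f P) (graphCurvature b f P) 2 ∧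
        ∀ x y : V, graphCurvature b f P x y ∘L graphCurvature b f P x y = 0) ∧
      (∃ ν : V → V × ℝ, ContDiffOn ℝ ∞ ν O ∧
        ∀ P ∈ O, IsUnitNormal (ambientForm b) (graphMap b f) P (ν P)) ∧
      ∀ P ∈ O, ∀ ν : V × ℝ, IsUnitNormal (ambientForm b) (graphMap b f) P ν →
        ambientForm b ν ν = 1 ∧
        (∀ x y, graphMetric b f P (graphShape b f P ν x) y =
          graphMetric b f P x (graphShape b f P ν y)) ∧
        graphCurvature b f P = curvatureOf (graphMetric b f P) (graphShape b f P ν) ∧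
        graphShape b f P ν ∘L graphShape b f P ν = 0 := by
  refine ⟨hasSignature_neutralForm b, hasSignature_ambientForm b,
    ⟨contDiff_graphMap b hf, isEmbedding_graphMap b hf.continuous, fun P x y h => ?_⟩, ?_⟩
  · rw [fderiv_graphMap_apply b hf, fderiv_graphMap_apply b hf] at h
    exact congrArg Prod.fst h
  have hopen : IsOpen {P : V | (hessian f (tildeProj b P)).det ≠ 0} :=
    isOpen_ne.preimage ((continuous_det_hessian hf).comp (tildeProj b).continuous)
  -- The ball only serves to keep the Hessian nondegenerate, for the rank statements; the other
  -- claims hold at every point of `V`.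
  obtain ⟨r, hr, hball⟩ := Metric.isOpen_iff.1 hopen 0 (by simpa using hHess)
  refine ⟨Metric.ball 0 r, Metric.isOpen_ball,
    (convex_ball 0 r).isConnected (Metric.nonempty_ball.2 hr), Metric.mem_ball_self hr,
    ⟨(contDiff_graphMetric b hf).contDiffOn, fun P _ => hasSignature_graphMetric b hf P⟩,
    fun P hP => ⟨(graph_jordanIP b hf (hball hP)).1, (graph_jordanIP b hf (hball hP)).2,
      fun x y => ContinuousLinearMap.ext (graphCurvature_comp_self b hf P x y)⟩,
    ⟨fun P => (-gradLift b f P, 1), ((contDiff_gradLift b hf).neg.prodMk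
      contDiff_const).contDiffOn, fun P _ => ?_⟩, fun P _ ν hν => ?_⟩
  · rw [isUnitNormal_graphMap_iff b hf]
    simp
  · have hc := ((isUnitNormal_graphMap_iff b hf P ν).1 hν).2
    refine ⟨ambientForm_self_of_isUnitNormal b hf hν, fun x y => ?_, ?_, ?_⟩
    · rw [graphMetric_symm b hf P x, graphShape_eq b hf]
      simp only [smul_apply, map_smul, graphMetric_hessLift b hf]
      rw [fderiv_fderiv_symm hf]
    · rw [graphShape_eq b hf, curvatureOf_smul _ _ hc, graphCurvature_eq b hf]
    · ext x
      simp [graphShape_eq b hf, hessLift_hessLift]
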